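/- Let $d\ge 2$ and let $K\subset\mathbb R^d$ be a convex body, i.e. a compact convex set with non-empty interior. For a unit vector $u$ let $K|u^\perp$ be the orthogonal projection of $K$ onto the hyperplane $u^\perp$. Let $A_S(K)=\mathcal H^{d-1}(\partial K)$ be the surface area of $K$, where $\mathcal H^{d-1}$ is the $(d-1)$-dimensional Hausdorff measure normalized to agree with Lebesgue measure on hyperplanes, and let $\sigma$ be the uniform (rotation-invariant) probability measure on the unit sphere $S^{d-1}$. Then $A_S(K)$ and all $\mathcal H^{d-1}(K|u^\perp)$ are finite, $u\mapsto\mathcal H^{d-1}(K|u^\perp)$ is $\sigma$-integrable, and $$\langle A_{\mathrm{proj}}\rangle:=\int_{S^{d-1}}\mathcal H^{d-1}(K|u^\perp)\,d\sigma(u)=k(d)\,A_S(K),$$ where $$k(d)=\frac{V_{d-1}}{S_d}=\frac{1}{\sqrt{\pi}\,(d-1)\,M_d},\qquad M_d=\frac{\Gamma\left(\frac{d-1}{2}\right)}{\Gamma\left(\frac d2\right)},$$ $V_{d-1}$ is the volume of the unit ball of $\mathbb R^{d-1}$ and $S_d$ is the surface area of the unit ball of $\mathbb R^d$. In particular $k(3)=\frac14$.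 -/

import Mathlib

open MeasureTheory
open scoped RealInnerProductSpace

noncomputable section

/-- The surface area of a set in `ℝᵈ`: the `(d - 1)`-dimensional Hausdorff measure of its
topological boundary, normalized so as to agree with Lebesgue measure on `(d - 1)`-dimensional
subspaces. -/
def surfaceArea {d : ℕ} (A : Set (EuclideanSpace ℝ (Fin d))) : ENNReal :=
  Measure.euclideanHausdorffMeasure (d - 1) (frontier A)

/-- The projected area of a set in `ℝᵈ` in direction `u`: the `(d - 1)`-dimensional volume of its
orthogonal projection onto the hyperplane `u^⊥`. -/
def projectedArea {d : ℕ} (A : Set (EuclideanSpace ℝ (Fin d))) (u : EuclideanSpace ℝ (Fin d)) :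
    ENNReal :=
  Measure.euclideanHausdorffMeasure (d - 1) ((ℝ ∙ u)ᗮ.starProjection '' A)

/-- The volume `V_n` of the unit ball of `ℝⁿ`. -/
def unitBallVolume (n : ℕ) : ℝ :=
  (volume (Metric.closedBall (0 : EuclideanSpace ℝ (Fin n)) 1)).toReal

/-- The surface area `S_n` of the unit ball of `ℝⁿ`, that is, the `(n - 1)`-dimensional measure of
the unit sphere. -/
def unitSphereArea (n : ℕ) : ℝ :=
  (surfaceArea (Metric.closedBall (0 : EuclideanSpace ℝ (Fin n)) 1)).toReal

/-- The ratio `k(d) = V_{d-1} / S_d`. -/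
def projectionRatio (d : ℕ) : ℝ :=
  unitBallVolume (d - 1) / unitSphereArea d

/-- The quotient `M_d = Γ((d - 1) / 2) / Γ(d / 2)`. -/
def gammaQuotient (d : ℕ) : ℝ :=
  Real.Gamma (((d : ℝ) - 1) / 2) / Real.Gamma ((d : ℝ) / 2)

/-- The average over all directions `u ∈ S^{d-1}`, with respect to the uniform (rotation invariant)
measure on the unit sphere, of the projected area of a set in `ℝᵈ`. -/
def averageProjectedArea {d : ℕ} (A : Set (EuclideanSpace ℝ (Fin d))) : ℝ :=
  ⨍ u : Metric.sphere (0 : EuclideanSpace ℝ (Fin d)) 1, (projectedArea A u).toReal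
    ∂(volume : Measure (EuclideanSpace ℝ (Fin d))).toSphere

end

/-! For a polytope the formula is a count of shadows. A facet with unit normal `n` projects along
`u` with its area multiplied by `|⟪u, n⟫|`, and the facets facing `u` and those facing `-u` each
tile the projection up to null sets. Hence twice the projected area is the sum of `|⟪u, n⟫|` times
facet area. Integrating in `u`, rotation invariance makes each cosine integral the same number, and
what remains is the surface area.

A convex body, translated so that `0` is interior, is squeezed as `K ⊆ P ⊆ r • K` with `P` a
polytope and `r > 1`. Projected area is monotone under inclusion; so is boundary area for convex
sets, because the nearest-point map is 1-Lipschitz (`euclideanHausdorffMeasure_frontier_mono`). Both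
are homogeneous of degree `m = d - 1`, so letting `r → 1` transfers the formula.

The constant is `V_{d-1} / S_d` because the unit ball must satisfy the formula too. Its Gamma form
comes from a Gaussian integral computed in polar and in Cartesian coordinates. -/

/-! ### Projection of sets lying in a hyperplane. -/

section HyperplaneMeasure

open Module

variable {E : Type*} [NormedAddCommGroup E] [InnerProductSpace ℝ E] [FiniteDimensional ℝ E]

/-- The orthogonal projection along a unit vector `u`, restricted to the orthogonal complement of a
unit vector `n`, scales volume by the factor `|⟪u, n⟫|`. -/
theorem normDet_starProjection_domRestrict_orthogonal {u n : E} (hu : ‖u‖ = 1) (hn : ‖n‖ = 1) :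
    ((ℝ ∙ u)ᗮ.starProjection.toLinearMap.domRestrict (ℝ ∙ n)ᗮ).normDet = |⟪u, n⟫| := by
  set W := (ℝ ∙ n)ᗮ
  set f := (ℝ ∙ u)ᗮ.starProjection.toLinearMap.domRestrict W with hf
  have hproj (v : E) (hv : ‖v‖ = 1) (x : E) : (ℝ ∙ v)ᗮ.starProjection x = x - ⟪v, x⟫ • v := by
    rw [Submodule.starProjection_orthogonal', sub_apply,
      Submodule.starProjection_unit_singleton ℝ hv]
    simp
  let b := stdOrthonormalBasis ℝ W
  -- With `v` the coordinates of the projection of `u` to `W`, the Gram matrix is `1 - v vᵀ`. Its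
  -- determinant is `1 - |v|²`, which Pythagoras turns into `⟪u, n⟫ ^ 2`.
  have hgram : Matrix.gram ℝ (fun i => f (b i)) = 1 - Matrix.vecMulVec
      (fun i => ⟪u, (b i : E)⟫) (fun i => ⟪u, (b i : E)⟫) := by
    ext i j
    have hij : ⟪(b i : E), (b j : E)⟫ = if i = j then 1 else 0 := by
      rw [← Submodule.coe_inner]
      exact orthonormal_iff_ite.mp b.orthonormal i j
    simp only [Matrix.gram_apply, hf, LinearMap.domRestrict_apply, ContinuousLinearMap.coe_coe,
      hproj u hu, Matrix.sub_apply, Matrix.one_apply, Matrix.vecMulVec_apply, inner_sub_left,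
      inner_sub_right, inner_smul_left, inner_smul_right, hij, real_inner_self_eq_norm_sq, hu,
      real_inner_comm u]
    simp
  have hsum : ∑ i, ⟪u, (b i : E)⟫ ^ 2 = 1 - ⟪u, n⟫ ^ 2 := by
    have h1 : ∑ i, ⟪u, (b i : E)⟫ ^ 2 = ‖W.orthogonalProjectionOnto u‖ ^ 2 := by
      rw [← b.sum_sq_norm_inner_right]
      refine Finset.sum_congr rfl fun i _ => ?_
      rw [Submodule.inner_orthogonalProjectionOnto_eq_of_mem_left, real_inner_comm,
        Real.norm_eq_abs, sq_abs]
    have h2 : (W.orthogonalProjectionOnto u : E) = u - ⟪n, u⟫ • n := hproj n hn u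
    rw [h1, Submodule.coe_norm, h2, norm_sub_sq_real, norm_smul, hu, hn, inner_smul_right,
      real_inner_comm u n, Real.norm_eq_abs, mul_one, sq_abs]
    ring
  have hsq : f.normDet ^ 2 = ⟪u, n⟫ ^ 2 := by
    have h := f.normDet_sq_eq_det_gram b
    rw [hgram, sub_eq_add_neg, ← Matrix.neg_vecMulVec, Matrix.vecMulVec_eq Unit,
      Matrix.det_one_add_replicateCol_mul_replicateRow] at h
    simp only [RCLike.ofReal_real_eq_id, id_eq] at h
    rw [h]
    have : (fun i => ⟪u, (b i : E)⟫) ⬝ᵥ (-fun i => ⟪u, (b i : E)⟫) = - (1 - ⟪u, n⟫ ^ 2) := by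
      rw [dotProduct_neg, ← hsum]
      simp [dotProduct, sq]
    rw [this]
    ring
  rw [← abs_of_nonneg f.normDet_nonneg]
  exact (sq_eq_sq_iff_abs_eq_abs _ _).mp hsq

omit [FiniteDimensional ℝ E] in
theorem finrank_orthogonal_span_singleton_of_norm_eq_one {m : ℕ} (hE : finrank ℝ E = m + 1) {n : E}
    (hn : ‖n‖ = 1) : finrank ℝ (ℝ ∙ n)ᗮ = m := by
  have : Fact (finrank ℝ E = m + 1) := ⟨hE⟩
  exact Submodule.finrank_orthogonal_span_singleton (by rintro rfl; simp at hn)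

variable [MeasurableSpace E] [BorelSpace E]

theorem euclideanHausdorffMeasure_finrank_lt_top_of_isBounded (W : Submodule ℝ E) {s : Set E}
    {p : E} (hs : ∀ x ∈ s, x - p ∈ W) (hb : Bornology.IsBounded s) :
    Measure.euclideanHausdorffMeasure (finrank ℝ W) s < ⊤ := by
  let g : W → E := fun w => w + p
  have hg : Isometry g := (isometry_add_right p).comp isometry_subtype_coe
  have hsg : s = g '' (g ⁻¹' s) := by
    rw [Set.image_preimage_eq_of_subset]
    exact fun x hx => ⟨⟨x - p, hs x hx⟩, by simp [g]⟩
  rw [hsg, hg.euclideanHausdorffMeasure_image, InnerProductSpace.euclideanHausdorffMeasure_eq_volume]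
  exact (hg.antilipschitz.isBounded_preimage hb).measure_lt_top

/-- Finite measure in one dimension rules out infinite measure in a higher one, leaving only zero.
This makes overlaps of facets negligible. -/
theorem euclideanHausdorffMeasure_eq_zero_of_finrank_lt (W : Submodule ℝ E) {k : ℕ}
    (hk : finrank ℝ W < k) {s : Set E} {p : E} (hs : ∀ x ∈ s, x - p ∈ W)
    (hb : Bornology.IsBounded s) : Measure.euclideanHausdorffMeasure k s = 0 :=
  (Measure.euclideanHausdorffMeasure_zero_or_top hk s).resolve_right
    (euclideanHausdorffMeasure_finrank_lt_top_of_isBounded W hs hb).ne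

theorem euclideanHausdorffMeasure_starProjection_image_of_subset_hyperplane {m : ℕ}
    (hE : finrank ℝ E = m + 1) {u n : E} (hu : ‖u‖ = 1) (hn : ‖n‖ = 1) {s : Set E} {p : E}
    (hs : ∀ x ∈ s, ⟪n, x⟫ = ⟪n, p⟫) :
    Measure.euclideanHausdorffMeasure m ((ℝ ∙ u)ᗮ.starProjection '' s) =
      ENNReal.ofReal |⟪u, n⟫| * Measure.euclideanHausdorffMeasure m s := by
  set W := (ℝ ∙ n)ᗮ
  have hW : finrank ℝ W = m := finrank_orthogonal_span_singleton_of_norm_eq_one hE hn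
  let g : W → E := fun w => w + p
  have hg : Isometry g := (isometry_add_right p).comp isometry_subtype_coe
  have hsg : s = g '' (g ⁻¹' s) := by
    rw [Set.image_preimage_eq_of_subset]
    refine fun x hx => ⟨⟨x - p, ?_⟩, by simp [g]⟩
    rw [Submodule.mem_orthogonal_singleton_iff_inner_right, inner_sub_right, hs x hx, sub_self]
  set f := (ℝ ∙ u)ᗮ.starProjection.toLinearMap.domRestrict W
  set q := (ℝ ∙ u)ᗮ.starProjection p
  have himg : (ℝ ∙ u)ᗮ.starProjection '' s = (fun x => x + q) '' (f '' (g ⁻¹' s)) := by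
    conv_lhs => rw [hsg]
    rw [Set.image_image, Set.image_image]
    refine Set.image_congr fun x _ => ?_
    exact map_add (ℝ ∙ u)ᗮ.starProjection (x : E) p
  have htr : Isometry (fun x : E => x + q) := isometry_add_right q
  have key := f.euclideanHausdorffMeasure_image (g ⁻¹' s)
  rw [normDet_starProjection_domRestrict_orthogonal hu hn, hW] at key
  rw [himg, htr.euclideanHausdorffMeasure_image, key]
  conv_rhs => rw [hsg]
  rw [hg.euclideanHausdorffMeasure_image]

end HyperplaneMeasure

theorem LipschitzWith.euclideanHausdorffMeasure_image_le {X Y : Type*} [EMetricSpace X]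
    [MeasurableSpace X] [BorelSpace X] [EMetricSpace Y] [MeasurableSpace Y] [BorelSpace Y]
    {f : X → Y} (hf : LipschitzWith 1 f) (m : ℕ) (s : Set X) :
    Measure.euclideanHausdorffMeasure m (f '' s) ≤ Measure.euclideanHausdorffMeasure m s := by
  simp_rw [Measure.euclideanHausdorffMeasure_def, Measure.smul_apply, ENNReal.smul_def, smul_eq_mul]
  gcongr
  simpa using hf.hausdorffMeasure_image_le (d := (m : ℝ)) (by positivity) s

/-! ### Cauchy's formula for polytopes, direction by direction. -/

section Polytope

open Module

variable {E : Type*} [NormedAddCommGroup E] [InnerProductSpace ℝ E]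

/-- The intersection of the half-spaces `⟪a, x⟫ ≤ 1` for `a` in a finite set. -/
def polarPolytope (A : Finset E) : Set E :=
  {x | ∀ a ∈ A, ⟪a, x⟫ ≤ 1}

/-- The face of `polarPolytope A` on the hyperplane `⟪a, x⟫ = 1`. -/
def polarFace (A : Finset E) (a : E) : Set E :=
  {x ∈ polarPolytope A | ⟪a, x⟫ = 1}

theorem isClosed_polarPolytope (A : Finset E) : IsClosed (polarPolytope A) := by
  have : polarPolytope A = ⋂ a ∈ A, {x | ⟪a, x⟫ ≤ 1} := by ext; simp [polarPolytope]
  rw [this]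
  exact isClosed_biInter fun a _ => isClosed_le (by fun_prop) continuous_const

theorem convex_polarPolytope (A : Finset E) : Convex ℝ (polarPolytope A) := by
  have : polarPolytope A = ⋂ a ∈ A, {x | ⟪a, x⟫ ≤ 1} := by ext; simp [polarPolytope]
  rw [this]
  exact convex_iInter₂ fun a _ => convex_halfSpace_le (innerₗ E a).isLinear 1

theorem zero_mem_interior_polarPolytope (A : Finset E) : (0 : E) ∈ interior (polarPolytope A) := by
  rw [mem_interior_iff_mem_nhds]
  have : ∀ a ∈ A, ∀ᶠ x in nhds (0 : E), ⟪a, x⟫ ≤ 1 := fun a _ => by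
    have h : Filter.Tendsto (fun x : E => ⟪a, x⟫) (nhds 0) (nhds 0) := by
      have : Continuous fun x : E => ⟪a, x⟫ := by fun_prop
      simpa using this.tendsto 0
    exact (h.eventually (gt_mem_nhds one_pos)).mono fun x hx => hx.le
  exact (Filter.eventually_all_finset A).mpr this

theorem isClosed_polarFace (A : Finset E) (a : E) : IsClosed (polarFace A a) :=
  (isClosed_polarPolytope A).inter (isClosed_eq (by fun_prop) continuous_const)

theorem polarFace_subset (A : Finset E) (a : E) : polarFace A a ⊆ polarPolytope A :=
  fun _ hx => hx.1

theorem frontier_polarPolytope (A : Finset E) :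
    frontier (polarPolytope A) = ⋃ a ∈ A, polarFace A a := by
  rw [(isClosed_polarPolytope A).frontier_eq]
  ext x
  simp only [Set.mem_sdiff, Set.mem_iUnion, exists_prop]
  constructor
  · rintro ⟨hx, hx'⟩
    by_contra! h
    refine hx' (mem_interior_iff_mem_nhds.mpr ?_)
    refine (Filter.eventually_all_finset A).mpr fun a ha => ?_
    have hlt : ⟪a, x⟫ < 1 := lt_of_le_of_ne (hx a ha) fun h' => h a ha ⟨hx, h'⟩
    have hc : Continuous fun x : E => ⟪a, x⟫ := by fun_prop
    exact ((hc.tendsto x).eventually (gt_mem_nhds hlt)).mono fun y hy => hy.le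
  · rintro ⟨a, ha, hx, hax⟩
    refine ⟨hx, fun hint => ?_⟩
    -- A small step from the face along its normal `a` violates `⟪a, ·⟫ ≤ 1`.
    have hc : Continuous fun t : ℝ => x + t • a := by fun_prop
    have h0 : Filter.Tendsto (fun t : ℝ => x + t • a) (nhdsWithin 0 (Set.Ioi 0)) (nhds x) := by
      simpa using (hc.tendsto 0).mono_left nhdsWithin_le_nhds
    obtain ⟨t, ht, ht0⟩ := ((h0.eventually (mem_interior_iff_mem_nhds.mp hint)).and
      self_mem_nhdsWithin).exists
    have h1 := ht a ha
    rw [inner_add_right, inner_smul_right, hax, real_inner_self_eq_norm_sq] at h1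
    have ha0 : a ≠ 0 := by rintro rfl; simp at hax
    have : 0 < t * ‖a‖ ^ 2 := mul_pos ht0 (by positivity)
    linarith

/-- Every line in direction `u` meeting a bounded polytope leaves it through a face whose outer
normal makes an acute angle with `u`. -/
theorem exists_add_smul_mem_polarFace {A : Finset E} (hA : Bornology.IsBounded (polarPolytope A))
    {u : E} (hu : u ≠ 0) {y : E} (hy : y ∈ polarPolytope A) :
    ∃ a ∈ A, 0 < ⟪a, u⟫ ∧ ∃ t : ℝ, y + t • u ∈ polarFace A a := by
  -- Otherwise the whole ray from `y` along `u` stays in the polytope. A displacement of length `R +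
  -- ‖y‖ + 1` already escapes the ball of radius `R`.
  have hne : (A.filter fun a => 0 < ⟪a, u⟫).Nonempty := by
    by_contra! h
    obtain ⟨R, hR⟩ := hA.subset_closedBall 0
    have hmem (t : ℝ) (ht : 0 ≤ t) : y + t • u ∈ polarPolytope A := fun a ha => by
      have : ⟪a, u⟫ ≤ 0 := by
        by_contra! h'
        exact (Finset.eq_empty_iff_forall_notMem.mp h) a (Finset.mem_filter.mpr ⟨ha, h'⟩)
      rw [inner_add_right, inner_smul_right]
      nlinarith [hy a ha, mul_nonneg ht (neg_nonneg.mpr this)]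
    have hu' : 0 < ‖u‖ := norm_pos_iff.mpr hu
    have hR0 : ‖y‖ ≤ R := by simpa using hR hy
    have ht : 0 ≤ (R + ‖y‖ + 1) / ‖u‖ := by
      have := norm_nonneg y
      exact div_nonneg (by linarith) hu'.le
    have h1 : ‖y + ((R + ‖y‖ + 1) / ‖u‖) • u‖ ≤ R := by simpa using hR (hmem _ ht)
    have h2 : ‖((R + ‖y‖ + 1) / ‖u‖) • u‖ = R + ‖y‖ + 1 := by
      rw [norm_smul, Real.norm_of_nonneg ht, div_mul_cancel₀ _ hu'.ne']
    have h3 := norm_sub_le (y + ((R + ‖y‖ + 1) / ‖u‖) • u) y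
    rw [add_sub_cancel_left, h2] at h3
    linarith
  -- The quotient is the time at which the ray reaches the hyperplane of `a`; the earliest one is
  -- the exit time.
  obtain ⟨a, ha, hmin⟩ := Finset.exists_min_image _ (fun a => (1 - ⟪a, y⟫) / ⟪a, u⟫) hne
  obtain ⟨haA, hau⟩ := Finset.mem_filter.mp ha
  refine ⟨a, haA, hau, (1 - ⟪a, y⟫) / ⟪a, u⟫, fun b hb => ?_, ?_⟩
  · rw [inner_add_right, inner_smul_right]
    rcases le_or_gt ⟪b, u⟫ 0 with h | h
    · have : 0 ≤ (1 - ⟪a, y⟫) / ⟪a, u⟫ := div_nonneg (by linarith [hy a haA]) hau.le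
      nlinarith [hy b hb, mul_nonneg this (neg_nonneg.mpr h)]
    · have := hmin b (Finset.mem_filter.mpr ⟨hb, h⟩)
      rw [le_div_iff₀ h] at this
      linarith
  · rw [inner_add_right, inner_smul_right, div_mul_cancel₀ _ hau.ne']
    ring

variable [FiniteDimensional ℝ E] [MeasurableSpace E] [BorelSpace E]

theorem euclideanHausdorffMeasure_polarFace_inter_eq_zero {m : ℕ} (hE : finrank ℝ E = m + 1)
    {A : Finset E} (hA : Bornology.IsBounded (polarPolytope A)) {a b : E} (hab : a ≠ b) :
    Measure.euclideanHausdorffMeasure m (polarFace A a ∩ polarFace A b) = 0 := by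
  rcases (polarFace A a ∩ polarFace A b).eq_empty_or_nonempty with h | ⟨p, hpa, hpb⟩
  · simp [h]
  have ha0 : a ≠ 0 := by rintro rfl; simpa using hpa.2
  have ha : finrank ℝ (ℝ ∙ a)ᗮ = m := by
    have : Fact (finrank ℝ E = m + 1) := ⟨hE⟩
    exact Submodule.finrank_orthogonal_span_singleton ha0
  have hlt : (ℝ ∙ a)ᗮ ⊓ (ℝ ∙ b)ᗮ < (ℝ ∙ a)ᗮ := by
    -- Equality would make `b` a multiple of `a`, and both take the value `1` at `p`.
    refine lt_of_le_of_ne inf_le_left fun h => hab ?_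
    have hle : (ℝ ∙ a)ᗮ ≤ (ℝ ∙ b)ᗮ := inf_eq_left.mp h
    have hle' : (ℝ ∙ b) ≤ (ℝ ∙ a) := by
      have := Submodule.orthogonal_le hle
      rwa [Submodule.orthogonal_orthogonal, Submodule.orthogonal_orthogonal] at this
    obtain ⟨t, ht⟩ := Submodule.mem_span_singleton.mp (hle' (Submodule.mem_span_singleton_self b))
    have : t = 1 := by
      have h := hpb.2
      rwa [← ht, real_inner_smul_left, hpa.2, mul_one] at h
    rw [← ht, this, one_smul]
  refine euclideanHausdorffMeasure_eq_zero_of_finrank_lt ((ℝ ∙ a)ᗮ ⊓ (ℝ ∙ b)ᗮ)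
    ((Submodule.finrank_lt_finrank_of_lt hlt).trans_eq ha) (p := p) ?_
    (hA.subset (Set.inter_subset_left.trans (polarFace_subset A a)))
  rintro x ⟨hxa, hxb⟩
  rw [Submodule.mem_inf, Submodule.mem_orthogonal_singleton_iff_inner_right,
    Submodule.mem_orthogonal_singleton_iff_inner_right, inner_sub_right, inner_sub_right, hxa.2,
    hxb.2, hpa.2, hpb.2]
  simp

theorem euclideanHausdorffMeasure_polarFace_lt_top {m : ℕ} (hE : finrank ℝ E = m + 1)
    {A : Finset E} (hA : Bornology.IsBounded (polarPolytope A)) (a : E) :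
    Measure.euclideanHausdorffMeasure m (polarFace A a) < ⊤ := by
  rcases (polarFace A a).eq_empty_or_nonempty with h | ⟨p, hp⟩
  · simp [h]
  have ha0 : a ≠ 0 := by rintro rfl; simpa using hp.2
  have ha : finrank ℝ (ℝ ∙ a)ᗮ = m := by
    have : Fact (finrank ℝ E = m + 1) := ⟨hE⟩
    exact Submodule.finrank_orthogonal_span_singleton ha0
  have := euclideanHausdorffMeasure_finrank_lt_top_of_isBounded (ℝ ∙ a)ᗮ (s := polarFace A a)
    (p := p) (fun x hx => ?_) (hA.subset (polarFace_subset A a))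
  · rwa [ha] at this
  · rw [Submodule.mem_orthogonal_singleton_iff_inner_right, inner_sub_right, hx.2, hp.2, sub_self]

theorem euclideanHausdorffMeasure_frontier_polarPolytope {m : ℕ} (hE : finrank ℝ E = m + 1)
    {A : Finset E} (hA : Bornology.IsBounded (polarPolytope A)) :
    Measure.euclideanHausdorffMeasure m (frontier (polarPolytope A)) =
      ∑ a ∈ A, Measure.euclideanHausdorffMeasure m (polarFace A a) := by
  rw [frontier_polarPolytope]
  refine measure_biUnion_finset₀ (fun a _ b _ hab => ?_) fun a _ =>
    (isClosed_polarFace A a).measurableSet.nullMeasurableSet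
  exact euclideanHausdorffMeasure_polarFace_inter_eq_zero hE hA hab

theorem euclideanHausdorffMeasure_starProjection_polarFace {m : ℕ} (hE : finrank ℝ E = m + 1)
    {u : E} (hu : ‖u‖ = 1) (A : Finset E) (a : E) :
    Measure.euclideanHausdorffMeasure m ((ℝ ∙ u)ᗮ.starProjection '' polarFace A a) =
      ENNReal.ofReal |⟪u, ‖a‖⁻¹ • a⟫| * Measure.euclideanHausdorffMeasure m (polarFace A a) := by
  rcases (polarFace A a).eq_empty_or_nonempty with h | ⟨p, hp⟩
  · simp [h]
  have ha0 : a ≠ 0 := by rintro rfl; simpa using hp.2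
  refine euclideanHausdorffMeasure_starProjection_image_of_subset_hyperplane hE hu
    (norm_smul_inv_norm ha0) (p := p) fun x hx => ?_
  rw [real_inner_smul_left, real_inner_smul_left, hx.2, hp.2]

omit [FiniteDimensional ℝ E] [MeasurableSpace E] [BorelSpace E] in
theorem starProjection_eq_iff_exists_add_smul {u x y : E} :
    (ℝ ∙ u)ᗮ.starProjection x = (ℝ ∙ u)ᗮ.starProjection y ↔ ∃ t : ℝ, y = x + t • u := by
  rw [eq_comm, ← sub_eq_zero, ← map_sub, Submodule.starProjection_apply_eq_zero_iff,
    Submodule.orthogonal_orthogonal, Submodule.mem_span_singleton]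
  exact exists_congr fun t => ⟨fun h => by rw [h]; abel, fun h => by rw [h]; abel⟩

/-- The projection of a bounded polytope is tiled by the projections of the faces on one side. -/
theorem euclideanHausdorffMeasure_starProjection_polarPolytope {m : ℕ}
    (hE : finrank ℝ E = m + 1) {A : Finset E} (hA : Bornology.IsBounded (polarPolytope A)) {u : E}
    (hu : ‖u‖ = 1) :
    Measure.euclideanHausdorffMeasure m ((ℝ ∙ u)ᗮ.starProjection '' polarPolytope A) =
      ∑ a ∈ A with 0 < ⟪a, u⟫, ENNReal.ofReal |⟪u, ‖a‖⁻¹ • a⟫| *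
        Measure.euclideanHausdorffMeasure m (polarFace A a) := by
  have hu0 : u ≠ 0 := by rintro rfl; simp at hu
  have himg : (ℝ ∙ u)ᗮ.starProjection '' polarPolytope A =
      ⋃ a ∈ A.filter fun a => 0 < ⟪a, u⟫, (ℝ ∙ u)ᗮ.starProjection '' polarFace A a := by
    refine subset_antisymm ?_ (Set.iUnion₂_subset fun a _ => Set.image_mono (polarFace_subset A a))
    rintro _ ⟨y, hy, rfl⟩
    obtain ⟨a, ha, hau, t, ht⟩ := exists_add_smul_mem_polarFace hA hu0 hy
    refine Set.mem_iUnion₂.mpr ⟨a, Finset.mem_filter.mpr ⟨ha, hau⟩, y + t • u, ht, ?_⟩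
    exact (starProjection_eq_iff_exists_add_smul.mpr ⟨t, rfl⟩).symm
  rw [himg, measure_biUnion_finset₀]
  · exact Finset.sum_congr rfl fun a _ => euclideanHausdorffMeasure_starProjection_polarFace hE hu A a
  · intro a ha b hb hab
    have ha := Finset.mem_filter.mp ha
    have hb := Finset.mem_filter.mp hb
    have hsub : (ℝ ∙ u)ᗮ.starProjection '' polarFace A a ∩ (ℝ ∙ u)ᗮ.starProjection '' polarFace A b ⊆
        (ℝ ∙ u)ᗮ.starProjection '' (polarFace A a ∩ polarFace A b) := by
      rintro _ ⟨⟨x, hx, rfl⟩, y, hy, hxy⟩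
      obtain ⟨t, rfl⟩ := starProjection_eq_iff_exists_add_smul.mp hxy.symm
      have h1 := hy.1 a ha.1
      have h2 := hy.2
      rw [inner_add_right, inner_smul_right] at h1 h2
      -- The constraint `a`, tight at `x`, forbids `t > 0`; the constraint `b`, tight at `x + t •
      -- u`, forbids `t < 0`. So projected faces overlap only in the projection of a null set.
      have ht : t = 0 := le_antisymm (by nlinarith [hx.2, ha.2]) (by nlinarith [hx.1 b hb.1, hb.2])
      subst ht
      rw [zero_smul, add_zero] at hy
      exact ⟨x, ⟨hx, hy⟩, rfl⟩
    refine measure_mono_null hsub ?_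
    exact le_antisymm (((ℝ ∙ u)ᗮ.lipschitzWith_starProjection.euclideanHausdorffMeasure_image_le m
      _).trans_eq (euclideanHausdorffMeasure_polarFace_inter_eq_zero hE hA hab)) bot_le
  · intro a _
    have hc : IsCompact (polarFace A a) :=
      Metric.isCompact_of_isClosed_isBounded (isClosed_polarFace A a) (hA.subset (polarFace_subset A a))
    exact (hc.image (by fun_prop)).measurableSet.nullMeasurableSet

/-- The directions `u` and `-u` have the same projection but select opposite faces; faces parallel
to `u` contribute zero. Adding the two tilings removes the sign condition, so the sum can be
integrated in `u`. -/
theorem two_mul_euclideanHausdorffMeasure_starProjection_polarPolytope {m : ℕ}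
    (hE : finrank ℝ E = m + 1) {A : Finset E} (hA : Bornology.IsBounded (polarPolytope A)) {u : E}
    (hu : ‖u‖ = 1) :
    2 * Measure.euclideanHausdorffMeasure m ((ℝ ∙ u)ᗮ.starProjection '' polarPolytope A) =
      ∑ a ∈ A, ENNReal.ofReal |⟪u, ‖a‖⁻¹ • a⟫| *
        Measure.euclideanHausdorffMeasure m (polarFace A a) := by
  have hpos := euclideanHausdorffMeasure_starProjection_polarPolytope hE hA hu
  have hneg := euclideanHausdorffMeasure_starProjection_polarPolytope hE hA
    (u := -u) (by rwa [norm_neg])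
  have hspan (W : Submodule ℝ E) (hW : W = ℝ ∙ u) :
      Wᗮ.starProjection = (ℝ ∙ u)ᗮ.starProjection := by subst hW; rfl
  rw [hspan _ (by rw [← Set.neg_singleton, Submodule.span_neg])] at hneg
  simp only [inner_neg_right, inner_neg_left, abs_neg, Left.neg_pos_iff] at hneg
  rw [two_mul]
  nth_rewrite 1 [hpos]
  rw [hneg, Finset.sum_filter, Finset.sum_filter, ← Finset.sum_add_distrib]
  refine Finset.sum_congr rfl fun a _ => ?_
  rcases lt_trichotomy ⟪a, u⟫ 0 with h | h | h
  · simp [h, h.not_gt]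
  · have : ⟪u, ‖a‖⁻¹ • a⟫ = 0 := by rw [inner_smul_right, real_inner_comm, h, mul_zero]
    simp [h, this]
  · simp [h, h.not_gt]

end Polytope

/-! ### Monotonicity of boundary area and polytope approximation. -/

section ConvexBodies

open Module
open scoped Pointwise

theorem IsPreconnected.inter_frontier_nonempty {X : Type*} [TopologicalSpace X] {s t : Set X}
    (hs : IsPreconnected s) (hin : (s ∩ t).Nonempty) (hout : (s ∩ tᶜ).Nonempty) :
    (s ∩ frontier t).Nonempty := by
  by_contra! h
  have hcover : s ⊆ interior t ∪ interior tᶜ := fun x hx => by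
    by_contra hx'
    rw [Set.mem_union, not_or, interior_compl, Set.mem_compl_iff, not_not] at hx'
    exact Set.eq_empty_iff_forall_notMem.mp h x ⟨hx, hx'.2, hx'.1⟩
  obtain ⟨x, hxs, hxt⟩ := hin
  obtain ⟨y, hys, hyt⟩ := hout
  have hx : x ∈ interior t :=
    (hcover hxs).resolve_right fun h' => interior_subset h' hxt
  have hy : y ∈ interior tᶜ :=
    (hcover hys).resolve_left fun h' => hyt (interior_subset h')
  obtain ⟨z, -, hz, hz'⟩ := hs _ _ isOpen_interior isOpen_interior hcover ⟨x, hxs, hx⟩ ⟨y, hys, hy⟩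
  exact interior_subset hz' (interior_subset hz)

variable {E : Type*} [NormedAddCommGroup E] [InnerProductSpace ℝ E]

/-- Adding the variational inequalities at `x` and `y` gives `‖f x - f y‖ ^ 2 ≤ ⟪x - y, f x - f y⟫`;
Cauchy–Schwarz finishes. -/
theorem exists_lipschitzWith_one_nearestPoint [CompleteSpace E] {K : Set E} (hc : IsClosed K)
    (hK : Convex ℝ K) (hne : K.Nonempty) :
    ∃ f : E → E, LipschitzWith 1 f ∧ (∀ x, f x ∈ K) ∧ ∀ x, ∀ y ∈ K, ⟪x - f x, y - f x⟫ ≤ 0 := by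
  have (x : E) : ∃ v ∈ K, ∀ y ∈ K, ⟪x - v, y - v⟫ ≤ 0 := by
    obtain ⟨v, hv, h⟩ := exists_norm_eq_iInf_of_complete_convex hne hc.isComplete hK x
    exact ⟨v, hv, (norm_eq_iInf_iff_real_inner_le_zero hK hv).mp h⟩
  choose f hfK hf using this
  refine ⟨f, LipschitzWith.of_dist_le_mul fun x y => ?_, hfK, hf⟩
  rw [NNReal.coe_one, one_mul, dist_eq_norm, dist_eq_norm]
  have h1 := hf x (f y) (hfK y)
  have h2 := hf y (f x) (hfK x)
  have h3 : ‖f x - f y‖ ^ 2 ≤ ⟪x - y, f x - f y⟫ := by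
    have e1 : ⟪x - f x, f y - f x⟫ = -⟪x, f x - f y⟫ + ⟪f x, f x - f y⟫ := by
      rw [← neg_sub (f x) (f y), inner_neg_right, inner_sub_left]; ring
    rw [e1] at h1
    rw [inner_sub_left] at h2
    rw [← real_inner_self_eq_norm_sq, inner_sub_left, inner_sub_left]
    linarith
  have h4 := h3.trans (real_inner_le_norm _ _)
  rcases (norm_nonneg (f x - f y)).eq_or_lt with h | h
  · rw [← h]; exact norm_nonneg _
  · rw [sq] at h4
    exact le_of_mul_le_mul_right h4 h

theorem exists_inner_le_of_notMem_interior [CompleteSpace E] {K : Set E} (hK : Convex ℝ K)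
    (hi : (interior K).Nonempty) {x : E} (hx : x ∉ interior K) :
    ∃ n : E, n ≠ 0 ∧ ∀ y ∈ K, ⟪n, y⟫ ≤ ⟪n, x⟫ := by
  obtain ⟨f, hf⟩ := geometric_hahn_banach_open_point hK.interior isOpen_interior hx
  set n := (InnerProductSpace.toDual ℝ E).symm f
  have hn (y : E) : ⟪n, y⟫ = f y := InnerProductSpace.toDual_symm_apply
  refine ⟨n, fun h0 => ?_, fun y hy => ?_⟩
  · obtain ⟨y, hy⟩ := hi
    have := hf y hy
    rw [← hn, ← hn, h0, inner_zero_left, inner_zero_left] at this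
    exact lt_irrefl _ this
  · have hcl : y ∈ closure (interior K) := by
      rw [hK.closure_interior_eq_closure_of_nonempty_interior hi]
      exact subset_closure hy
    have hclosed : IsClosed {z : E | ⟪n, z⟫ ≤ ⟪n, x⟫} := isClosed_le (by fun_prop) continuous_const
    exact closure_minimal (fun z hz => by simpa [hn] using (hf z hz).le) hclosed hcl

theorem exists_add_smul_mem_frontier {L : Set E} (hL : Bornology.IsBounded L) {x n : E}
    (hx : x ∈ L) (hn : n ≠ 0) : ∃ t : ℝ, 0 ≤ t ∧ x + t • n ∈ frontier L := by
  have hray : IsPreconnected ((fun t : ℝ => x + t • n) '' Set.Ici 0) :=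
    isPreconnected_Ici.image _ (by fun_prop)
  have hin : (((fun t : ℝ => x + t • n) '' Set.Ici 0) ∩ L).Nonempty :=
    ⟨x, ⟨0, by simp⟩, hx⟩
  have hout : (((fun t : ℝ => x + t • n) '' Set.Ici 0) ∩ Lᶜ).Nonempty := by
    obtain ⟨R, hR⟩ := hL.subset_closedBall 0
    have hn' : 0 < ‖n‖ := norm_pos_iff.mpr hn
    have hxR : ‖x‖ ≤ R := by simpa using hR hx
    have ht : 0 ≤ (R + ‖x‖ + 1) / ‖n‖ := by
      have := norm_nonneg x
      exact div_nonneg (by linarith) hn'.le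
    refine ⟨_, ⟨_, ht, rfl⟩, fun hmem => ?_⟩
    have h1 : ‖x + ((R + ‖x‖ + 1) / ‖n‖) • n‖ ≤ R := by simpa using hR hmem
    have h2 : ‖((R + ‖x‖ + 1) / ‖n‖) • n‖ = R + ‖x‖ + 1 := by
      rw [norm_smul, Real.norm_of_nonneg ht, div_mul_cancel₀ _ hn'.ne']
    have h3 := norm_sub_le (x + ((R + ‖x‖ + 1) / ‖n‖) • n) x
    rw [add_sub_cancel_left, h2] at h3
    linarith
  obtain ⟨_, ⟨t, ht, rfl⟩, hfr⟩ := hray.inter_frontier_nonempty hin hout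
  exact ⟨t, ht, hfr⟩

/-- The boundary measure of convex sets is monotone. -/
theorem euclideanHausdorffMeasure_frontier_mono [CompleteSpace E] [MeasurableSpace E]
    [BorelSpace E] (m : ℕ) {K L : Set E} (hc : IsClosed K) (hK : Convex ℝ K)
    (hi : (interior K).Nonempty) (hL : Bornology.IsBounded L) (hKL : K ⊆ L) :
    Measure.euclideanHausdorffMeasure m (frontier K) ≤
      Measure.euclideanHausdorffMeasure m (frontier L) := by
  obtain ⟨f, hlip, hfK, hf⟩ :=
    exists_lipschitzWith_one_nearestPoint hc hK (hi.mono interior_subset)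
  refine (measure_mono fun x hx => ?_).trans (hlip.euclideanHausdorffMeasure_image_le m (frontier L))
  rw [hc.frontier_eq] at hx
  -- Follow an outer normal at `x` until it meets `frontier L`. The nearest point of `K` to that
  -- point is `x`, so `f` maps `frontier L` over `frontier K`.
  obtain ⟨n, hn, hsupp⟩ := exists_inner_le_of_notMem_interior hK hi hx.2
  obtain ⟨t, ht, hmem⟩ := exists_add_smul_mem_frontier hL (hKL hx.1) hn
  refine ⟨x + t • n, hmem, ?_⟩
  set z := f (x + t • n)
  have h1 := hf (x + t • n) x hx.1
  have h2 := mul_nonneg ht (sub_nonneg.mpr (hsupp z (hfK _)))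
  have h3 : ⟪x + t • n - z, x - z⟫ = ‖x - z‖ ^ 2 + t * (⟪n, x⟫ - ⟪n, z⟫) := by
    rw [← real_inner_self_eq_norm_sq, ← inner_sub_right, ← real_inner_smul_left, ← inner_add_left]
    congr 1
    abel
  have h4 : ‖x - z‖ ^ 2 ≤ 0 := by linarith
  have h5 : ‖x - z‖ = 0 := by simpa using le_antisymm h4 (sq_nonneg _)
  exact (sub_eq_zero.mp (norm_eq_zero.mp h5)).symm

/-- A convex body with the origin in its interior is approximated by polytopes. -/
theorem exists_polarPolytope_between [CompleteSpace E] {K : Set E} (hc : IsCompact K)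
    (hK : Convex ℝ K) (h0 : (0 : E) ∈ interior K) {r : ℝ} (hr : 1 < r) :
    ∃ A : Finset E, K ⊆ polarPolytope A ∧ polarPolytope A ⊆ r • K := by
  classical
  have hKr : K ⊆ interior (r • K) := by
    have h := hK.closure_subset_interior_image_homothety_of_one_lt h0 r hr
    have himg : AffineMap.homothety (0 : E) r '' K = r • K := by
      ext y
      simp [AffineMap.homothety_apply, Set.mem_smul_set]
    rw [himg] at h
    exact subset_closure.trans h
  -- The separating level is positive because `0 ∈ K`, so it can be scaled to `1`. By compactness
  -- finitely many such `a` cut off all of `frontier (r • K)`.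
  have hsep (x : E) (hx : x ∈ frontier (r • K)) : ∃ a : E, (∀ y ∈ K, ⟪a, y⟫ ≤ 1) ∧ 1 < ⟪a, x⟫ := by
    have hxK : x ∉ K := fun h => hx.2 (hKr h)
    obtain ⟨f, c, hfK, hfx⟩ := geometric_hahn_banach_closed_point hK hc.isClosed hxK
    have hc0 : 0 < c := by simpa using hfK 0 (interior_subset h0)
    refine ⟨c⁻¹ • (InnerProductSpace.toDual ℝ E).symm f, fun y hy => ?_, ?_⟩
    · rw [real_inner_smul_left, InnerProductSpace.toDual_symm_apply, inv_mul_le_iff₀ hc0, mul_one]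
      exact (hfK y hy).le
    · rw [real_inner_smul_left, InnerProductSpace.toDual_symm_apply, lt_inv_mul_iff₀ hc0, mul_one]
      exact hfx
  choose! a haK hax using hsep
  have hcomp : IsCompact (frontier (r • K)) :=
    (hc.smul r).of_isClosed_subset isClosed_frontier (hc.smul r).isClosed.frontier_subset
  obtain ⟨t, htS, ht⟩ := hcomp.elim_nhds_subcover (fun x => {y | 1 < ⟪a x, y⟫}) fun x hx =>
    (isOpen_lt continuous_const (by fun_prop)).mem_nhds (hax x hx)
  refine ⟨t.image a, fun y hy b hb => ?_, fun y hy => ?_⟩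
  · obtain ⟨x, hx, rfl⟩ := Finset.mem_image.mp hb
    exact haK x (htS x hx) y hy
  · by_contra hyK
    -- The polytope is connected and contains `0`, so leaving `r • K` would mean crossing its
    -- frontier, where some constraint fails.
    obtain ⟨z, hzP, hzS⟩ := (convex_polarPolytope (t.image a)).isPreconnected.inter_frontier_nonempty
      (t := r • K) ⟨0, interior_subset (zero_mem_interior_polarPolytope _),
        interior_subset (hKr (interior_subset h0))⟩ ⟨y, hy, hyK⟩
    obtain ⟨x, hx, hzx⟩ := Set.mem_iUnion₂.mp (ht hzS)
    exact not_lt_of_ge (hzP (a x) (Finset.mem_image_of_mem a hx)) hzx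

end ConvexBodies

/-! ### Passage from polytopes to convex bodies. -/

section CauchyFormula

open Module Filter Topology
open scoped Pointwise ENNReal

theorem ENNReal.le_of_forall_one_lt_le_pow_mul {m : ℕ} {x y : ℝ≥0∞}
    (h : ∀ r : ℝ, 1 < r → x ≤ ENNReal.ofReal r ^ m * y) : x ≤ y := by
  have ht : Tendsto (fun r : ℝ => ENNReal.ofReal r ^ m * y) (𝓝[>] 1) (𝓝 y) := by
    have h1 : Tendsto (fun r : ℝ => ENNReal.ofReal r ^ m) (𝓝[>] 1) (𝓝 1) := by
      have hc : Continuous fun r : ℝ => ENNReal.ofReal r ^ m :=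
        (ENNReal.continuous_pow m).comp ENNReal.continuous_ofReal
      simpa using (hc.tendsto 1).mono_left nhdsWithin_le_nhds
    simpa using ENNReal.Tendsto.mul_const h1 (Or.inl one_ne_zero)
  exact ge_of_tendsto ht (eventually_mem_nhdsWithin.mono fun r hr => h r hr)

variable {E : Type*} [NormedAddCommGroup E] [InnerProductSpace ℝ E] [MeasurableSpace E]
  [BorelSpace E]

theorem euclideanHausdorffMeasure_smul_of_pos (m : ℕ) {r : ℝ} (hr : 0 < r) (s : Set E) :
    Measure.euclideanHausdorffMeasure m (r • s) =
      ENNReal.ofReal r ^ m * Measure.euclideanHausdorffMeasure m s := by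
  rw [Measure.euclideanHausdorffMeasure_smul₀ m hr.ne', ENNReal.smul_def, smul_eq_mul,
    ENNReal.coe_pow, ← Real.enorm_of_nonneg hr.le]
  rfl

omit [MeasurableSpace E] [BorelSpace E] in
theorem frontier_smul_of_ne_zero {r : ℝ} (hr : r ≠ 0) (s : Set E) :
    frontier (r • s) = r • frontier s := by
  rw [frontier, frontier, closure_smul₀, interior_smul₀ hr, Set.smul_set_sdiff₀ hr]

variable [FiniteDimensional ℝ E]

theorem exists_polarPolytope_sandwich (m : ℕ) {K : Set E} (hc : IsCompact K) (hK : Convex ℝ K)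
    (h0 : (0 : E) ∈ interior K) {r : ℝ} (hr : 1 < r) :
    ∃ A : Finset E, Bornology.IsBounded (polarPolytope A) ∧
      Measure.euclideanHausdorffMeasure m (frontier K) ≤
        Measure.euclideanHausdorffMeasure m (frontier (polarPolytope A)) ∧
      Measure.euclideanHausdorffMeasure m (frontier (polarPolytope A)) ≤
        ENNReal.ofReal r ^ m * Measure.euclideanHausdorffMeasure m (frontier K) ∧
      ∀ u : E,
        Measure.euclideanHausdorffMeasure m ((ℝ ∙ u)ᗮ.starProjection '' K) ≤
          Measure.euclideanHausdorffMeasure m ((ℝ ∙ u)ᗮ.starProjection '' polarPolytope A) ∧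
        Measure.euclideanHausdorffMeasure m ((ℝ ∙ u)ᗮ.starProjection '' polarPolytope A) ≤
          ENNReal.ofReal r ^ m *
            Measure.euclideanHausdorffMeasure m ((ℝ ∙ u)ᗮ.starProjection '' K) := by
  obtain ⟨A, hKA, hAK⟩ := exists_polarPolytope_between hc hK h0 hr
  have hr0 : 0 < r := one_pos.trans hr
  have hb : Bornology.IsBounded (polarPolytope A) := (hc.smul r).isBounded.subset hAK
  refine ⟨A, hb, euclideanHausdorffMeasure_frontier_mono m hc.isClosed hK ⟨0, h0⟩ hb hKA, ?_,
    fun u => ⟨measure_mono (Set.image_mono hKA), ?_⟩⟩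
  · rw [← euclideanHausdorffMeasure_smul_of_pos m hr0, ← frontier_smul_of_ne_zero hr0.ne']
    exact euclideanHausdorffMeasure_frontier_mono m (isClosed_polarPolytope A)
      (convex_polarPolytope A) ⟨0, zero_mem_interior_polarPolytope A⟩ (hc.smul r).isBounded hAK
  · rw [← euclideanHausdorffMeasure_smul_of_pos m hr0, ← image_smul_set]
    exact measure_mono (Set.image_mono hAK)

variable {m : ℕ} (hE : finrank ℝ E = m + 1) {K : Set E} (hc : IsCompact K) (hK : Convex ℝ K)
  (h0 : (0 : E) ∈ interior K)

include hE hc hK h0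

theorem euclideanHausdorffMeasure_frontier_lt_top_of_convex :
    Measure.euclideanHausdorffMeasure m (frontier K) < ⊤ := by
  obtain ⟨A, hA, h, -⟩ := exists_polarPolytope_sandwich m hc hK h0 one_lt_two
  refine h.trans_lt ?_
  rw [euclideanHausdorffMeasure_frontier_polarPolytope hE hA]
  exact ENNReal.sum_lt_top.mpr fun a _ => euclideanHausdorffMeasure_polarFace_lt_top hE hA a

theorem euclideanHausdorffMeasure_starProjection_lt_top_of_convex {u : E} (hu : ‖u‖ = 1) :
    Measure.euclideanHausdorffMeasure m ((ℝ ∙ u)ᗮ.starProjection '' K) < ⊤ := by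
  obtain ⟨A, hA, -, -, h⟩ := exists_polarPolytope_sandwich m hc hK h0 one_lt_two
  refine (h u).1.trans_lt ?_
  rw [euclideanHausdorffMeasure_starProjection_polarPolytope hE hA hu]
  exact ENNReal.sum_lt_top.mpr fun a _ => ENNReal.mul_lt_top ENNReal.ofReal_lt_top
    (euclideanHausdorffMeasure_polarFace_lt_top hE hA a)

/-- For polytopes the function is a finite sum of measurable terms; the general case is a pointwise
limit of these along `r = 1 + 1 / (k + 1)`. -/
theorem measurable_euclideanHausdorffMeasure_starProjection_of_convex :
    Measurable fun u : Metric.sphere (0 : E) 1 =>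
      Measure.euclideanHausdorffMeasure m ((ℝ ∙ (u : E))ᗮ.starProjection '' K) := by
  have hr (k : ℕ) : (1 : ℝ) < 1 + 1 / ((k : ℝ) + 1) := by
    have : (0 : ℝ) < 1 / ((k : ℝ) + 1) := by positivity
    linarith
  choose A hA _ _ h using fun k => exists_polarPolytope_sandwich m hc hK h0 (hr k)
  refine measurable_of_tendsto_metrizable (f := fun k (u : Metric.sphere (0 : E) 1) =>
    Measure.euclideanHausdorffMeasure m ((ℝ ∙ (u : E))ᗮ.starProjection '' polarPolytope (A k)))
    (fun k => ?_) (tendsto_pi_nhds.mpr fun u => ?_)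
  · have heq (u : Metric.sphere (0 : E) 1) : Measure.euclideanHausdorffMeasure m
        ((ℝ ∙ (u : E))ᗮ.starProjection '' polarPolytope (A k)) =
        2⁻¹ * ∑ a ∈ A k, ENNReal.ofReal |⟪(u : E), ‖a‖⁻¹ • a⟫| *
          Measure.euclideanHausdorffMeasure m (polarFace (A k) a) := by
      rw [← two_mul_euclideanHausdorffMeasure_starProjection_polarPolytope hE (hA k)
        (norm_eq_of_mem_sphere u), ← mul_assoc, ENNReal.inv_mul_cancel two_ne_zero
        ENNReal.ofNat_ne_top, one_mul]
    simp_rw [heq]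
    fun_prop
  · refine tendsto_of_tendsto_of_tendsto_of_le_of_le tendsto_const_nhds ?_
      (fun k => (h k u).1) (fun k => (h k u).2)
    have h1 : Tendsto (fun k : ℕ => (1 : ℝ) + 1 / ((k : ℝ) + 1)) atTop (𝓝 1) := by
      simpa using tendsto_one_div_add_atTop_nhds_zero_nat.const_add (1 : ℝ)
    have h2 : Tendsto (fun k : ℕ => ENNReal.ofReal (1 + 1 / ((k : ℝ) + 1)) ^ m) atTop (𝓝 1) := by
      have hcont : Continuous fun r : ℝ => ENNReal.ofReal r ^ m :=
        (ENNReal.continuous_pow m).comp ENNReal.continuous_ofReal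
      have h := (hcont.tendsto 1).comp h1
      rwa [ENNReal.ofReal_one, one_pow] at h
    simpa using ENNReal.Tendsto.mul_const h2 (Or.inl one_ne_zero)

/-- Cauchy's formula for a measure on the sphere whose cosine transform is constant. -/
theorem two_mul_lintegral_euclideanHausdorffMeasure_starProjection_of_convex
    {σ : Measure (Metric.sphere (0 : E) 1)} {κ : ℝ≥0∞}
    (hσ : ∀ n : E, ‖n‖ = 1 → ∫⁻ u, ENNReal.ofReal |⟪(u : E), n⟫| ∂σ = κ) :
    2 * ∫⁻ u : Metric.sphere (0 : E) 1,
        Measure.euclideanHausdorffMeasure m ((ℝ ∙ (u : E))ᗮ.starProjection '' K) ∂σ =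
      κ * Measure.euclideanHausdorffMeasure m (frontier K) := by
  have hpoly (A : Finset E) (hA : Bornology.IsBounded (polarPolytope A)) :
      2 * ∫⁻ u : Metric.sphere (0 : E) 1, Measure.euclideanHausdorffMeasure m
        ((ℝ ∙ (u : E))ᗮ.starProjection '' polarPolytope A) ∂σ =
      κ * Measure.euclideanHausdorffMeasure m (frontier (polarPolytope A)) := by
    rw [← lintegral_const_mul' _ _ ENNReal.ofNat_ne_top]
    simp_rw [fun u : Metric.sphere (0 : E) 1 =>
      two_mul_euclideanHausdorffMeasure_starProjection_polarPolytope hE hA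
        (norm_eq_of_mem_sphere u)]
    rw [lintegral_finsetSum _ fun a _ => by fun_prop,
      euclideanHausdorffMeasure_frontier_polarPolytope hE hA, Finset.mul_sum]
    refine Finset.sum_congr rfl fun a _ => ?_
    rw [lintegral_mul_const _ (by fun_prop)]
    -- The vector `a = 0` has no unit normal, but its face is empty.
    rcases (polarFace A a).eq_empty_or_nonempty with h | ⟨p, hp⟩
    · simp [h]
    · have ha0 : a ≠ 0 := by rintro rfl; simpa using hp.2
      rw [hσ (‖a‖⁻¹ • a) (norm_smul_inv_norm ha0)]
  refine le_antisymm (ENNReal.le_of_forall_one_lt_le_pow_mul (m := m) fun r hr => ?_)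
    (ENNReal.le_of_forall_one_lt_le_pow_mul (m := m) fun r hr => ?_)
  all_goals
    obtain ⟨A, hA, h1, h2, h3⟩ := exists_polarPolytope_sandwich m hc hK h0 hr
  · refine le_trans ?_ ((hpoly A hA).trans_le ((mul_le_mul_right h2 κ).trans_eq
      (mul_left_comm _ _ _)))
    exact mul_le_mul_right (lintegral_mono fun u : Metric.sphere (0 : E) 1 => (h3 u).1) 2
  · refine (mul_le_mul_right h1 κ).trans ((hpoly A hA).symm.trans_le ?_)
    rw [mul_left_comm, ← lintegral_const_mul' _ _ (ENNReal.pow_ne_top ENNReal.ofReal_ne_top)]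
    exact mul_le_mul_right (lintegral_mono fun u : Metric.sphere (0 : E) 1 => (h3 u).2) 2

end CauchyFormula

/-! ### The cosine integral and the mass of the sphere via Gaussians. -/

section CosineTransform

open Module

theorem integral_abs_inner_pow_mul_exp_neg_norm_sq {E : Type*} [NormedAddCommGroup E]
    [InnerProductSpace ℝ E] [FiniteDimensional ℝ E] [Nontrivial E] [MeasurableSpace E]
    [BorelSpace E] (n : E) (k : ℕ) :
    ∫ x : E, |⟪x, n⟫| ^ k * Real.exp (-‖x‖ ^ 2) =
      (∫ u : Metric.sphere (0 : E) 1, |⟪(u : E), n⟫| ^ k ∂(volume : Measure E).toSphere) *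
        ∫ r in Set.Ioi (0 : ℝ), r ^ (finrank ℝ E - 1 + k) * Real.exp (-r ^ 2) := by
  let g : Metric.sphere (0 : E) 1 × Set.Ioi (0 : ℝ) → ℝ := fun y =>
    |⟪(y.1 : E), n⟫| ^ k * ((y.2 : ℝ) ^ k * Real.exp (-(y.2 : ℝ) ^ 2))
  have hg (x : ({0}ᶜ : Set E)) :
      g (homeomorphUnitSphereProd E x) = |⟪(x : E), n⟫| ^ k * Real.exp (-‖(x : E)‖ ^ 2) := by
    have hx : 0 < ‖(x : E)‖ := norm_pos_iff.mpr x.2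
    simp only [g, homeomorphUnitSphereProd_apply_fst_coe, homeomorphUnitSphereProd_apply_snd_coe]
    rw [← mul_assoc, ← mul_pow, real_inner_smul_left, abs_mul, abs_of_pos (inv_pos.mpr hx)]
    congr 2
    field_simp
  calc ∫ x : E, |⟪x, n⟫| ^ k * Real.exp (-‖x‖ ^ 2)
      = ∫ x : ({0}ᶜ : Set E), |⟪(x : E), n⟫| ^ k * Real.exp (-‖(x : E)‖ ^ 2)
          ∂(Measure.comap Subtype.val volume) := by
        rw [integral_subtype_comap (measurableSet_singleton _).compl
          fun x : E => |⟪x, n⟫| ^ k * Real.exp (-‖x‖ ^ 2), MeasureTheory.restrict_compl_singleton]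
    _ = ∫ y, g y ∂(volume : Measure E).toSphere.prod (.volumeIoiPow (finrank ℝ E - 1)) := by
        rw [← (volume : Measure E).measurePreserving_homeomorphUnitSphereProd.integral_comp
          (Homeomorph.measurableEmbedding _) g]
        exact integral_congr_ae (.of_forall fun x => (hg x).symm)
    _ = (∫ u : Metric.sphere (0 : E) 1, |⟪(u : E), n⟫| ^ k ∂(volume : Measure E).toSphere) *
          ∫ r : Set.Ioi (0 : ℝ), (r : ℝ) ^ k * Real.exp (-(r : ℝ) ^ 2)
            ∂(.volumeIoiPow (finrank ℝ E - 1)) :=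
        integral_prod_mul (fun u : Metric.sphere (0 : E) 1 => |⟪(u : E), n⟫| ^ k)
          (fun r : Set.Ioi (0 : ℝ) => (r : ℝ) ^ k * Real.exp (-(r : ℝ) ^ 2))
    _ = _ := by
        congr 1
        simp only [Measure.volumeIoiPow, ENNReal.ofReal]
        rw [integral_withDensity_eq_integral_smul, integral_subtype_comap measurableSet_Ioi
          fun a : ℝ => Real.toNNReal (a ^ (finrank ℝ E - 1)) • (a ^ k * Real.exp (-a ^ 2)),
          setIntegral_congr_fun measurableSet_Ioi fun x hx => ?_]
        · rw [NNReal.smul_def, Real.coe_toNNReal _ (pow_nonneg hx.out.le _), smul_eq_mul,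
            ← mul_assoc, ← pow_add]
        · exact (measurable_subtype_coe.pow_const _).real_toNNReal

theorem integral_Ioi_pow_mul_exp_neg_sq (k : ℕ) :
    ∫ r in Set.Ioi (0 : ℝ), r ^ k * Real.exp (-r ^ 2) = 1 / 2 * Real.Gamma (((k : ℝ) + 1) / 2) := by
  have h := integral_rpow_mul_exp_neg_rpow (p := 2) (q := k) two_pos
    (by have := k.cast_nonneg (α := ℝ); linarith)
  rw [← h]
  refine setIntegral_congr_fun measurableSet_Ioi fun r _ => ?_
  simp only [Real.rpow_natCast, Real.rpow_two]

theorem integral_abs_pow_mul_exp_neg_sq (k : ℕ) :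
    ∫ t : ℝ, |t| ^ k * Real.exp (-t ^ 2) = Real.Gamma (((k : ℝ) + 1) / 2) := by
  have h := integral_comp_abs (f := fun t : ℝ => t ^ k * Real.exp (-t ^ 2))
  simp only [sq_abs] at h
  rw [h, integral_Ioi_pow_mul_exp_neg_sq]
  ring

theorem integral_abs_coord_zero_pow_mul_exp_neg_norm_sq (m k : ℕ) :
    ∫ x : EuclideanSpace ℝ (Fin (m + 1)), |x 0| ^ k * Real.exp (-‖x‖ ^ 2) =
      Real.Gamma (((k : ℝ) + 1) / 2) * Real.Gamma (1 / 2) ^ m := by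
  have h0 := integral_abs_pow_mul_exp_neg_sq 0
  simp only [pow_zero, one_mul, Nat.cast_zero, zero_add] at h0
  let f : Fin (m + 1) → ℝ → ℝ := Fin.cons (fun t => |t| ^ k * Real.exp (-t ^ 2))
    (fun _ t => Real.exp (-t ^ 2))
  have hf (x : EuclideanSpace ℝ (Fin (m + 1))) :
      |x 0| ^ k * Real.exp (-‖x‖ ^ 2) = ∏ i, f i (x i) := by
    rw [EuclideanSpace.norm_sq_eq, Fin.prod_univ_succ, Fin.sum_univ_succ]
    simp only [f, Fin.cons_zero, Fin.cons_succ, Real.norm_eq_abs, sq_abs]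
    rw [neg_add, Real.exp_add, ← Finset.sum_neg_distrib, Real.exp_sum, mul_assoc]
  simp_rw [hf]
  have hpi := (EuclideanSpace.volume_preserving_symm_measurableEquiv_toLp
    (Fin (m + 1))).integral_comp' (fun x : Fin (m + 1) → ℝ => ∏ i, f i (x i))
  refine hpi.trans ?_
  rw [integral_fintype_prod_volume_eq_prod, Fin.prod_univ_succ]
  simp only [f, Fin.cons_zero, Fin.cons_succ]
  rw [integral_abs_pow_mul_exp_neg_sq, Finset.prod_const, h0]
  simp

/-- The case `k = 1` is the cosine integral, `k = 0` the total mass. The right side does not involve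
`n`, which is the needed rotation invariance. -/
theorem integral_toSphere_abs_inner_pow_mul_Gamma (m k : ℕ)
    {n : EuclideanSpace ℝ (Fin (m + 1))} (hn : ‖n‖ = 1) :
    (∫ u : Metric.sphere (0 : EuclideanSpace ℝ (Fin (m + 1))) 1,
        |⟪(u : EuclideanSpace ℝ (Fin (m + 1))), n⟫| ^ k
          ∂(volume : Measure (EuclideanSpace ℝ (Fin (m + 1)))).toSphere) *
      (1 / 2 * Real.Gamma (((m : ℝ) + k + 1) / 2)) =
      Real.Gamma (((k : ℝ) + 1) / 2) * Real.Gamma (1 / 2) ^ m := by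
  have h1 := integral_abs_inner_pow_mul_exp_neg_norm_sq n k
  rw [finrank_euclideanSpace_fin, Nat.add_sub_cancel, integral_Ioi_pow_mul_exp_neg_sq,
    Nat.cast_add] at h1
  rw [← h1, ← integral_abs_coord_zero_pow_mul_exp_neg_norm_sq]
  set e : EuclideanSpace ℝ (Fin (m + 1)) := EuclideanSpace.single 0 1
  have he : ‖e‖ = ‖n‖ := by simp [e, hn]
  -- This reflection carries `e` to `n`, since their norms agree, and so reduces the integral to the
  -- first coordinate.
  set R := (ℝ ∙ (e - n))ᗮ.reflection
  have hR : R e = n := Submodule.reflection_sub he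
  rw [← R.measurePreserving.integral_comp R.toHomeomorph.measurableEmbedding]
  refine integral_congr_ae (.of_forall fun x => ?_)
  have : ⟪R x, n⟫ = x 0 := by
    rw [← hR, LinearIsometryEquiv.inner_map_map]
    simp [e, EuclideanSpace.inner_single_right]
  simp only [this, LinearIsometryEquiv.norm_map]

end CosineTransform

/-! ### Assembly and evaluation of the constant. -/

section MainTheorem

open Module

variable {d m : ℕ}

theorem surfaceArea_image_add_right (p : EuclideanSpace ℝ (Fin d))
    (K : Set (EuclideanSpace ℝ (Fin d))) : surfaceArea ((· + p) '' K) = surfaceArea K := by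
  have h := (Homeomorph.addRight p).image_frontier K
  rw [surfaceArea, surfaceArea,
    ← (isometry_add_right p).euclideanHausdorffMeasure_image (frontier K)]
  exact congrArg _ h.symm

theorem projectedArea_image_add_right (p : EuclideanSpace ℝ (Fin d))
    (K : Set (EuclideanSpace ℝ (Fin d))) (u : EuclideanSpace ℝ (Fin d)) :
    projectedArea ((· + p) '' K) u = projectedArea K u := by
  rw [projectedArea, projectedArea, ← (isometry_add_right
    ((ℝ ∙ u)ᗮ.starProjection p)).euclideanHausdorffMeasure_image (_ '' K), Set.image_image,
    Set.image_image]
  simp only [map_add]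

theorem projectedArea_closedBall {u : EuclideanSpace ℝ (Fin (m + 1))} (hu : ‖u‖ = 1) :
    projectedArea (Metric.closedBall (0 : EuclideanSpace ℝ (Fin (m + 1))) 1) u =
      volume (Metric.closedBall (0 : EuclideanSpace ℝ (Fin m)) 1) := by
  have hW : finrank ℝ (ℝ ∙ u)ᗮ = m :=
    finrank_orthogonal_span_singleton_of_norm_eq_one (finrank_euclideanSpace_fin) hu
  let e := ((stdOrthonormalBasis ℝ (ℝ ∙ u)ᗮ).reindex (finCongr hW)).repr.symm
  have hg : Isometry fun x => ((e x : (ℝ ∙ u)ᗮ) : EuclideanSpace ℝ (Fin (m + 1))) :=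
    isometry_subtype_coe.comp e.isometry
  rw [← EuclideanSpace.euclideanHausdorffMeasure_eq_volume, ← hg.euclideanHausdorffMeasure_image,
    projectedArea, Nat.add_sub_cancel]
  congr 1
  ext y
  simp only [Set.mem_image, mem_closedBall_zero_iff]
  constructor
  · rintro ⟨x, hx, rfl⟩
    refine ⟨e.symm ((ℝ ∙ u)ᗮ.orthogonalProjectionOnto x), ?_, by simp⟩
    rw [LinearIsometryEquiv.norm_map]
    exact ((ℝ ∙ u)ᗮ.norm_orthogonalProjectionOnto_apply_le x).trans hx
  · rintro ⟨x, hx, rfl⟩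
    refine ⟨e x, by rwa [← Submodule.coe_norm, LinearIsometryEquiv.norm_map], ?_⟩
    exact Submodule.starProjection_eq_self_iff.mpr (e x).2

/-- The integral of `u ↦ |⟪u, e⟫|` over the unit sphere, for a fixed unit vector `e`. -/
noncomputable def cosineIntegral (m : ℕ) : ℝ :=
  ∫ u : Metric.sphere (0 : EuclideanSpace ℝ (Fin (m + 1))) 1,
    |⟪(u : EuclideanSpace ℝ (Fin (m + 1))), EuclideanSpace.single 0 1⟫|
      ∂(volume : Measure (EuclideanSpace ℝ (Fin (m + 1)))).toSphere

theorem cosineIntegral_mul_Gamma (m : ℕ) :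
    cosineIntegral m * (1 / 2 * Real.Gamma ((m : ℝ) / 2 + 1)) = Real.Gamma (1 / 2) ^ m := by
  have h := integral_toSphere_abs_inner_pow_mul_Gamma m 1
    (n := EuclideanSpace.single 0 1) (by simp)
  simp only [pow_one, Nat.cast_one] at h
  rw [cosineIntegral, show (m : ℝ) / 2 + 1 = ((m : ℝ) + 1 + 1) / 2 by ring, h]
  norm_num

theorem toSphere_real_univ_mul_Gamma (m : ℕ) :
    (volume : Measure (EuclideanSpace ℝ (Fin (m + 1)))).toSphere.real Set.univ *
      (1 / 2 * Real.Gamma (((m : ℝ) + 1) / 2)) = Real.Gamma (1 / 2) ^ (m + 1) := by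
  have h := integral_toSphere_abs_inner_pow_mul_Gamma m 0
    (n := EuclideanSpace.single 0 1) (by simp)
  simp only [pow_zero, integral_const, smul_eq_mul, mul_one, Nat.cast_zero, add_zero,
    zero_add] at h
  rw [h, pow_succ']

theorem lintegral_toSphere_abs_inner {n : EuclideanSpace ℝ (Fin (m + 1))} (hn : ‖n‖ = 1) :
    ∫⁻ u : Metric.sphere (0 : EuclideanSpace ℝ (Fin (m + 1))) 1,
      ENNReal.ofReal |⟪(u : EuclideanSpace ℝ (Fin (m + 1))), n⟫|
        ∂(volume : Measure (EuclideanSpace ℝ (Fin (m + 1)))).toSphere =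
      ENNReal.ofReal (cosineIntegral m) := by
  rw [← ofReal_integral_eq_lintegral_ofReal _ (.of_forall fun _ => abs_nonneg _)]
  · congr 1
    have h := integral_toSphere_abs_inner_pow_mul_Gamma m 1 hn
    have h' := integral_toSphere_abs_inner_pow_mul_Gamma m 1
      (n := EuclideanSpace.single 0 1) (by simp)
    simp only [pow_one] at h h'
    have hpos : 0 < 1 / 2 * Real.Gamma (((m : ℝ) + (1 : ℕ) + 1) / 2) :=
      mul_pos (by norm_num) (Real.Gamma_pos_of_pos (by positivity))
    exact mul_right_cancel₀ hpos.ne' (h.trans h'.symm)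
  · refine Integrable.of_bound (C := 1) (by fun_prop) (.of_forall fun u => ?_)
    rw [Real.norm_eq_abs, abs_abs]
    exact (abs_real_inner_le_norm _ _).trans (by rw [hn, norm_eq_of_mem_sphere]; norm_num)

theorem cauchy_surfaceArea_of_convex {K : Set (EuclideanSpace ℝ (Fin (m + 1)))} (hc : IsCompact K)
    (hK : Convex ℝ K) (hi : (interior K).Nonempty) :
    surfaceArea K ≠ ⊤ ∧
      (∀ u : Metric.sphere (0 : EuclideanSpace ℝ (Fin (m + 1))) 1, projectedArea K u ≠ ⊤) ∧
      Integrable (fun u : Metric.sphere (0 : EuclideanSpace ℝ (Fin (m + 1))) 1 =>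
        (projectedArea K u).toReal)
        (volume : Measure (EuclideanSpace ℝ (Fin (m + 1)))).toSphere ∧
      2 * (volume : Measure (EuclideanSpace ℝ (Fin (m + 1)))).toSphere.real Set.univ *
        averageProjectedArea K = cosineIntegral m * (surfaceArea K).toReal := by
  obtain ⟨p, hp⟩ := hi
  have hE : finrank ℝ (EuclideanSpace ℝ (Fin (m + 1))) = m + 1 := finrank_euclideanSpace_fin
  set L := (· + -p) '' K with hL
  have hLc : IsCompact L := hc.image (by fun_prop)
  have hLK : Convex ℝ L := by
    simpa [hL, sub_eq_add_neg, add_comm] using hK.translate (-p)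
  have hL0 : (0 : EuclideanSpace ℝ (Fin (m + 1))) ∈ interior L := by
    have h := (Homeomorph.addRight (-p)).image_interior K
    have h' : (0 : EuclideanSpace ℝ (Fin (m + 1))) ∈ (Homeomorph.addRight (-p)) '' interior K :=
      ⟨p, hp, by simp⟩
    rw [h] at h'
    exact h'
  have hS : surfaceArea K < ⊤ := by
    rw [← surfaceArea_image_add_right (-p)]
    exact euclideanHausdorffMeasure_frontier_lt_top_of_convex hE hLc hLK hL0
  have hproj (u : Metric.sphere (0 : EuclideanSpace ℝ (Fin (m + 1))) 1) :
      projectedArea K u < ⊤ := by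
    rw [← projectedArea_image_add_right (-p)]
    exact euclideanHausdorffMeasure_starProjection_lt_top_of_convex hE hLc hLK hL0
      (norm_eq_of_mem_sphere u)
  have hmeas : Measurable fun u : Metric.sphere (0 : EuclideanSpace ℝ (Fin (m + 1))) 1 =>
      projectedArea K u := by
    simp_rw [← projectedArea_image_add_right (-p) K]
    exact measurable_euclideanHausdorffMeasure_starProjection_of_convex hE hLc hLK hL0
  have hint : 2 * ∫⁻ u : Metric.sphere (0 : EuclideanSpace ℝ (Fin (m + 1))) 1, projectedArea K u
      ∂(volume : Measure (EuclideanSpace ℝ (Fin (m + 1)))).toSphere =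
      ENNReal.ofReal (cosineIntegral m) * surfaceArea K := by
    simp_rw [← projectedArea_image_add_right (-p) K]
    rw [← surfaceArea_image_add_right (-p)]
    exact two_mul_lintegral_euclideanHausdorffMeasure_starProjection_of_convex hE hLc hLK hL0
      fun n hn => lintegral_toSphere_abs_inner hn
  have hfin : ∫⁻ u : Metric.sphere (0 : EuclideanSpace ℝ (Fin (m + 1))) 1, projectedArea K u
      ∂(volume : Measure (EuclideanSpace ℝ (Fin (m + 1)))).toSphere ≠ ⊤ := fun h => by
    rw [h, ENNReal.mul_top two_ne_zero] at hint
    exact ENNReal.mul_ne_top ENNReal.ofReal_ne_top hS.ne hint.symm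
  refine ⟨hS.ne, fun u => (hproj u).ne,
    integrable_toReal_of_lintegral_ne_top hmeas.aemeasurable hfin, ?_⟩
  have h := congrArg ENNReal.toReal hint
  have hcos : 0 ≤ cosineIntegral m := integral_nonneg fun _ => abs_nonneg _
  rw [ENNReal.toReal_mul, ENNReal.toReal_mul, ENNReal.toReal_ofReal hcos, ENNReal.toReal_ofNat,
    ← integral_toReal hmeas.aemeasurable (.of_forall hproj)] at h
  rw [averageProjectedArea, mul_assoc, ← smul_eq_mul (_ : ℝ) (⨍ _, _ ∂_), measure_smul_average, h]

/-- The unit ball has constant projected area `V_m`, so Cauchy's formula for it identifies the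
constant without computing the Hausdorff measure of the sphere. -/
theorem projectionRatio_mul_two_mul_toSphere (m : ℕ) :
    projectionRatio (m + 1) *
      (2 * (volume : Measure (EuclideanSpace ℝ (Fin (m + 1)))).toSphere.real Set.univ) =
      cosineIntegral m := by
  set σ := (volume : Measure (EuclideanSpace ℝ (Fin (m + 1)))).toSphere
  obtain ⟨-, -, -, h⟩ := cauchy_surfaceArea_of_convex
    (isCompact_closedBall (0 : EuclideanSpace ℝ (Fin (m + 1))) 1) (convex_closedBall _ _)
    ⟨0, Metric.ball_subset_interior_closedBall (Metric.mem_ball_self one_pos)⟩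
  have hV : 0 < unitBallVolume m := ENNReal.toReal_pos
    (Metric.measure_closedBall_pos _ _ one_pos).ne' measure_closedBall_lt_top.ne
  have hσ : 0 < σ.real Set.univ := ENNReal.toReal_pos
    (Measure.measure_univ_ne_zero.mpr (Measure.toSphere_ne_zero _)) (measure_ne_top _ _)
  have havg : averageProjectedArea (Metric.closedBall (0 : EuclideanSpace ℝ (Fin (m + 1))) 1) =
      unitBallVolume m := by
    have hconst (u : Metric.sphere (0 : EuclideanSpace ℝ (Fin (m + 1))) 1) :
        (projectedArea (Metric.closedBall (0 : EuclideanSpace ℝ (Fin (m + 1))) 1) u).toReal =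
          unitBallVolume m := by
      rw [projectedArea_closedBall (norm_eq_of_mem_sphere u), unitBallVolume]
    have : NeZero σ := ⟨Measure.toSphere_ne_zero _⟩
    rw [averageProjectedArea]
    simp_rw [hconst]
    exact average_const _ _
  rw [havg] at h
  change _ = cosineIntegral m * unitSphereArea (m + 1) at h
  -- Positivity of `V_m` and of the mass of `σ` forces this through the formula itself.
  have hS : unitSphereArea (m + 1) ≠ 0 := fun h0 => by
    rw [h0, mul_zero] at h
    exact (mul_pos (mul_pos two_pos hσ) hV).ne' h
  rw [projectionRatio, Nat.add_sub_cancel, div_mul_eq_mul_div, div_eq_iff hS, ← h, mul_comm]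

theorem projectionRatio_eq (hm : m ≠ 0) :
    projectionRatio (m + 1) =
      1 / (Real.sqrt Real.pi * (((m + 1 : ℕ) : ℝ) - 1) * gammaQuotient (m + 1)) := by
  have h1 := cosineIntegral_mul_Gamma m
  have h2 := toSphere_real_univ_mul_Gamma m
  have h3 := projectionRatio_mul_two_mul_toSphere m
  have hm' : (0 : ℝ) < m := Nat.cast_pos.mpr (Nat.pos_of_ne_zero hm)
  have hG1 : 0 < Real.Gamma ((m : ℝ) / 2) := Real.Gamma_pos_of_pos (by positivity)
  have hG2 : 0 < Real.Gamma (((m : ℝ) + 1) / 2) := Real.Gamma_pos_of_pos (by positivity)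
  have hpi : 0 < Real.sqrt Real.pi := Real.sqrt_pos.mpr Real.pi_pos
  rw [Real.Gamma_add_one (by positivity), Real.Gamma_one_half_eq] at h1
  rw [Real.Gamma_one_half_eq, pow_succ] at h2
  have hpow : 0 < Real.sqrt Real.pi ^ m := pow_pos hpi m
  rw [gammaQuotient, Nat.cast_add, Nat.cast_one, add_sub_cancel_right]
  set a := (volume : Measure (EuclideanSpace ℝ (Fin (m + 1)))).toSphere.real Set.univ
  set G := Real.Gamma ((m : ℝ) / 2)
  set H := Real.Gamma (((m : ℝ) + 1) / 2)
  -- Here `h1` carries `√π ^ m` and `h2` carries `√π ^ (m + 1)`; eliminating the mass `a` leaves a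
  -- single `√π`.
  have key : projectionRatio (m + 1) * (Real.sqrt Real.pi * m * G) = H := by
    rw [← h3] at h1
    have h4 : projectionRatio (m + 1) * (m * G) * a * (1 / 2 * H) =
        Real.sqrt Real.pi ^ m * H := by linear_combination H * h1
    have h5 : Real.sqrt Real.pi ^ m * (projectionRatio (m + 1) * (Real.sqrt Real.pi * m * G)) =
        Real.sqrt Real.pi ^ m * H := by
      linear_combination h4 - projectionRatio (m + 1) * (m * G) * h2
    exact mul_left_cancel₀ hpow.ne' h5
  rw [eq_div_iff (by positivity), ← mul_div_assoc, ← mul_div_assoc, key, div_self hG2.ne']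

end MainTheorem

theorem mainTheorem1 (d : ℕ) (hd : 2 ≤ d) :
    -- Cauchy's formula, every quantity in it being finite and the average being a true one
    (∀ K : ConvexBody (EuclideanSpace ℝ (Fin d)),
      (interior (K : Set (EuclideanSpace ℝ (Fin d)))).Nonempty →
        surfaceArea (K : Set (EuclideanSpace ℝ (Fin d))) ≠ ⊤ ∧
        (∀ u : Metric.sphere (0 : EuclideanSpace ℝ (Fin d)) 1,
          projectedArea (K : Set (EuclideanSpace ℝ (Fin d))) u ≠ ⊤) ∧
        Integrable
          (fun u : Metric.sphere (0 : EuclideanSpace ℝ (Fin d)) 1 =>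
            (projectedArea (K : Set (EuclideanSpace ℝ (Fin d))) u).toReal)
          (volume : Measure (EuclideanSpace ℝ (Fin d))).toSphere ∧
        averageProjectedArea (K : Set (EuclideanSpace ℝ (Fin d))) =
          projectionRatio d * (surfaceArea (K : Set (EuclideanSpace ℝ (Fin d)))).toReal) ∧
    -- the explicit value of the constant
    projectionRatio d = 1 / (Real.sqrt Real.pi * ((d : ℝ) - 1) * gammaQuotient d) ∧
    (d = 3 → projectionRatio d = 1 / 4) := by
  obtain ⟨m, rfl⟩ : ∃ m, d = m + 1 := ⟨d - 1, by omega⟩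
  have hratio := projectionRatio_eq (m := m) (by omega)
  refine ⟨fun K hK => ?_, hratio, fun h3 => ?_⟩
  · obtain ⟨h1, h2, h3, h4⟩ := cauchy_surfaceArea_of_convex K.isCompact K.convex hK
    refine ⟨h1, h2, h3, ?_⟩
    rw [← projectionRatio_mul_two_mul_toSphere m] at h4
    have hσ : (volume : Measure (EuclideanSpace ℝ (Fin (m + 1)))).toSphere.real Set.univ ≠ 0 := by
      rw [measureReal_ne_zero_iff, Measure.measure_univ_ne_zero]
      exact Measure.toSphere_ne_zero _
    refine mul_left_cancel₀ (mul_ne_zero two_ne_zero hσ) (h4.trans ?_)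
    ring
  · obtain rfl : m = 2 := by omega
    have h32 : Real.Gamma (3 / 2) = 1 / 2 * Real.sqrt Real.pi := by
      rw [show (3 / 2 : ℝ) = 1 / 2 + 1 by norm_num, Real.Gamma_add_one (by norm_num),
        Real.Gamma_one_half_eq]
    have hpi : Real.sqrt Real.pi ≠ 0 := (Real.sqrt_pos.mpr Real.pi_pos).ne'
    rw [hratio, gammaQuotient]
    norm_num
    rw [h32]
    field_simp
    norm_num
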